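/- Let $k$ be a field of arbitrary characteristic and let $\Lambda$ be a finite-dimensional $k$-algebra; all modules are finitely generated. Let $\widehat{\mathcal C}$ be the category of complete local commutative Noetherian $k$-algebras with residue field $k$, whose morphisms are the continuous $k$-algebra homomorphisms that induce the identity on $k$. Let $V$ be a left $\Lambda$-module. For $R$ in $\widehat{\mathcal C}$, a lift of $V$ over $R$ is a pair $(M,\phi)$ of a finitely generated left $R\otimes_k\Lambda$-module $M$ that is free over $R$ and an isomorphism of $\Lambda$-modules $\phi\colon k\otimes_R M\to V$. Lifts $(M,\phi)$ and $(M',\phi')$ over $R$ are isomorphic if there is an isomorphism $f\colon M\to M'$ of $R\otimes_k\Lambda$-modules with $\phi'\circ(\mathrm{id}_k\otimes f)=\phi$. A morphism $\theta\colon R\to S$ in $\widehat{\mathcal C}$ sends $(M,\phi)$ to the lift $(S\otimes_{R,\theta}M,\phi_\theta)$, where $\phi_\theta$ is the composite $k\otimes_S(S\otimes_{R,\theta}M)\cong k\otimes_R M\xrightarrow{\phi}V$. An object $R(\Lambda,V)$ of $\widehat{\mathcal C}$ is a universal deformation ring of $V$ if there is a lift $U$ of $V$ over $R(\Lambda,V)$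 such that for every $S$ in $\widehat{\mathcal C}$ and every lift $L$ of $V$ over $S$ there is exactly one morphism $\psi\colon R(\Lambda,V)\to S$ that sends $U$ to a lift isomorphic to $L$. The module $V$ is strongly Gorenstein-projective if there is a short exact sequence $0\to V\to P\to V\to 0$ of $\Lambda$-modules with $P$ projective, and $\mathrm{Ext}^1_\Lambda(V,P')=0$ for all projective $\Lambda$-modules $P'$. Its stable endomorphism ring $\underline{\mathrm{End}}_\Lambda(V)$ is the $k$-algebra $\mathrm{End}_\Lambda(V)$ modulo the ideal of endomorphisms that factor through a projective $\Lambda$-module. **Theorem 1.2.** If $V$ is strongly Gorenstein-projective and $\underline{\mathrm{End}}_\Lambda(V)\cong k$ as $k$-algebras, then $V$ has a universal deformation ring, and every universal deformation ring $R(\Lambda,V)$ of $V$ is isomorphic, as a $k$-algebra, to $k[\![t]\!]/(t^2)$. -/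

import Mathlib

open scoped TensorProduct Topology
open CategoryTheory

universe u

noncomputable section

/-! ### Stable endomorphism rings and strongly Gorenstein-projective modules -/

section Modules

variable (Λ : Type u) [Ring Λ] (V : Type u) [AddCommGroup V] [Module Λ V]

/-- The endomorphism `f` of `V` factors through a finitely generated projective `Λ`-module. -/
def FactorsThroughProjective (f : Module.End Λ V) : Prop :=
  ∃ (Q : Type u) (_ : AddCommGroup Q) (_ : Module Λ Q),
    Module.Finite Λ Q ∧ Module.Projective Λ Q ∧
      ∃ (g : V →ₗ[Λ] Q) (h : Q →ₗ[Λ] V), f = h ∘ₗ g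

/-- The two-sided ideal of `End_Λ(V)` of the endomorphisms that factor through a
projective module. -/
def projectiveEndIdeal : TwoSidedIdeal (Module.End Λ V) :=
  TwoSidedIdeal.mk' {f | FactorsThroughProjective Λ V f}
    ⟨Λ, inferInstance, inferInstance, inferInstance, inferInstance, 0, 0, by simp⟩
    (by
      rintro _ _ ⟨Q, _, _, _, _, g, h, rfl⟩ ⟨Q', _, _, _, _, g', h', rfl⟩
      exact ⟨Q × Q', inferInstance, inferInstance, inferInstance, inferInstance,
        g.prod g', h.coprod h', by ext; simp⟩)
    (by
      rintro _ ⟨Q, _, _, _, _, g, h, rfl⟩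
      exact ⟨Q, _, _, ‹_›, ‹_›, g, -h, by ext; simp⟩)
    (by
      rintro a _ ⟨Q, _, _, _, _, g, h, rfl⟩
      exact ⟨Q, _, _, ‹_›, ‹_›, g, a ∘ₗ h, by ext; simp⟩)
    (by
      rintro _ b ⟨Q, _, _, _, _, g, h, rfl⟩
      exact ⟨Q, _, _, ‹_›, ‹_›, g ∘ₗ b, h, by ext; simp⟩)

/-- The stable endomorphism ring of `V`: `End_Λ(V)` modulo the endomorphisms that factor
through a projective module. If `Λ` is a `k`-algebra, this is a `k`-algebra. -/
abbrev StableEnd : Type u := (projectiveEndIdeal Λ V).ringCon.Quotient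

/-- `V` is strongly Gorenstein-projective: there is a short exact sequence
`0 → V → P → V → 0` with `P` projective, and `Ext¹_Λ(V, P') = 0` for all projective `P'`.
All modules are finitely generated. -/
def IsStronglyGorensteinProjective : Prop :=
  (∃ (P : Type u) (_ : AddCommGroup P) (_ : Module Λ P) (i : V →ₗ[Λ] P) (p : P →ₗ[Λ] V),
    Module.Finite Λ P ∧ Module.Projective Λ P ∧
      Function.Injective i ∧ Function.Exact i p ∧ Function.Surjective p) ∧
  ∀ (P' : Type u) [AddCommGroup P'] [Module Λ P'] [Module.Finite Λ P'] [Module.Projective Λ P'],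
    Subsingleton (Abelian.Ext.{u} (ModuleCat.of Λ V) (ModuleCat.of Λ P') 1)

end Modules

/-! ### The category of complete local Noetherian `k`-algebras with residue field `k` -/

/-- A complete local commutative Noetherian `k`-algebra with residue field `k`. -/
structure CompleteLocalAlg (k : Type u) [Field k] : Type (u + 1) where
  /-- the underlying type -/
  carrier : Type u
  [commRing : CommRing carrier]
  [algebra : Algebra k carrier]
  [isLocalRing : IsLocalRing carrier]
  [isNoetherianRing : IsNoetherianRing carrier]
  [isAdicComplete : IsAdicComplete (IsLocalRing.maximalIdeal carrier) carrier]
  bijective_residue : Function.Bijective (algebraMap k (IsLocalRing.ResidueField carrier))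

namespace CompleteLocalAlg

variable {k : Type u} [Field k]

instance : CoeSort (CompleteLocalAlg k) (Type u) := ⟨carrier⟩

attribute [instance] commRing algebra isLocalRing isNoetherianRing isAdicComplete

/-- The augmentation `R → R/𝔪 = k`. -/
def residue (R : CompleteLocalAlg k) : R →ₐ[k] k :=
  ((AlgEquiv.ofBijective (Algebra.ofId k (IsLocalRing.ResidueField R))
    R.bijective_residue).symm : IsLocalRing.ResidueField R →ₐ[k] k).comp
    (IsScalarTower.toAlgHom k R (IsLocalRing.ResidueField R))

/-- `k` as an algebra over `R`, through the augmentation. -/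
instance residueAlgebra (R : CompleteLocalAlg k) : Algebra R k := R.residue.toRingHom.toAlgebra

instance (R : CompleteLocalAlg k) : IsScalarTower k R k :=
  IsScalarTower.of_algebraMap_eq fun x => (R.residue.commutes x).symm

/-- A morphism: a continuous homomorphism of `k`-algebras that induces the identity on the
residue field `k`. Continuity for the adic topologies is automatic, see `Hom.continuous`. -/
@[ext]
structure Hom (R S : CompleteLocalAlg k) where
  /-- the underlying homomorphism of `k`-algebras -/
  toAlgHom : R →ₐ[k] S
  residue_comp : ∀ r : R, S.residue (toAlgHom r) = R.residue r

theorem residue_eq_zero_iff (R : CompleteLocalAlg k) (r : R) :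
    R.residue r = 0 ↔ r ∈ IsLocalRing.maximalIdeal R := by
  rw [← IsLocalRing.residue_eq_zero_iff]
  exact map_eq_zero_iff (AlgEquiv.ofBijective (Algebra.ofId k (IsLocalRing.ResidueField R))
    R.bijective_residue).symm (AlgEquiv.injective _)

theorem Hom.continuous {R S : CompleteLocalAlg k} (f : Hom R S) :
    Continuous[(IsLocalRing.maximalIdeal R).adicTopology,
      (IsLocalRing.maximalIdeal S).adicTopology] f.toAlgHom := by
  let := (IsLocalRing.maximalIdeal R).adicTopology
  let := (IsLocalRing.maximalIdeal S).adicTopology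
  have hm : IsLocalRing.maximalIdeal R ≤
      (IsLocalRing.maximalIdeal S).comap f.toAlgHom.toRingHom := fun r hr =>
    (S.residue_eq_zero_iff _).1 ((f.residue_comp r).trans ((R.residue_eq_zero_iff r).2 hr))
  refine continuous_of_continuousAt_zero f.toAlgHom.toRingHom.toAddMonoidHom ?_
  have h0 := (IsLocalRing.maximalIdeal R).hasBasis_nhds_zero_adic
  have h1 := (IsLocalRing.maximalIdeal S).hasBasis_nhds_zero_adic
  rw [ContinuousAt, map_zero]
  refine (h0.tendsto_iff h1).2 fun n _ => ⟨n, trivial, fun x hx => ?_⟩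
  exact (Ideal.pow_right_mono hm n).trans (Ideal.le_comap_pow _ n) hx

end CompleteLocalAlg

/-! ### Lifts -/

/-- If `Λ` acts on `M` by `R`-linear maps, it acts on `A ⊗[R] M` through the factor `M`. -/
abbrev rightFactorModule (Λ R A M : Type*) [Ring Λ] [CommRing R] [AddCommGroup A] [Module R A]
    [AddCommGroup M] [Module R M] [Module Λ M] [SMulCommClass R Λ M] :
    Module Λ (A ⊗[R] M) :=
  letI : SMulCommClass Λ R M := SMulCommClass.symm _ _ _
  Module.compHom (A ⊗[R] M)
    ((Module.End.lTensorAlgHom R M A).toRingHom.comp (Module.toModuleEnd R (S := Λ) M))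

/-- A left module over `RΛ = R ⊗[k] Λ`, together with its restrictions to `R` and to `Λ`
(`tmul_smul` says that these are the restrictions, so they are no additional data). -/
structure TensorModule (k : Type u) [Field k] (Λ : Type u) [Ring Λ] [Algebra k Λ]
    (R : CompleteLocalAlg k) : Type (u + 1) where
  /-- the underlying type -/
  carrier : Type u
  [addCommGroup : AddCommGroup carrier]
  [module : Module (R ⊗[k] Λ) carrier]
  [moduleLeft : Module R carrier]
  [moduleRight : Module Λ carrier]
  tmul_smul : ∀ (r : R) (a : Λ) (m : carrier), (r ⊗ₜ[k] a) • m = r • a • m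

namespace TensorModule

variable {k : Type u} [Field k] {Λ : Type u} [Ring Λ] [Algebra k Λ] {R : CompleteLocalAlg k}

instance : CoeSort (TensorModule k Λ R) (Type u) := ⟨carrier⟩

attribute [instance] addCommGroup module moduleLeft moduleRight

variable (M : TensorModule k Λ R)

instance : SMulCommClass R Λ M where
  smul_comm r a m := by
    have h1 := M.tmul_smul r 1 (a • m)
    have h2 := M.tmul_smul 1 a (r • m)
    have h3 := M.tmul_smul r 1 m
    have h4 := M.tmul_smul 1 a m
    rw [one_smul] at h1 h2 h3 h4
    rw [← h1, ← h2, ← h3, ← h4, ← mul_smul, ← mul_smul]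
    simp

instance : IsScalarTower R (R ⊗[k] Λ) M where
  smul_assoc r x m := by
    have h1 := M.tmul_smul r 1 (x • m)
    rw [one_smul] at h1
    rw [← h1, ← mul_smul]
    refine congrArg (· • m) (?_ : r • x = _)
    clear h1
    induction x with
    | zero => simp
    | tmul s a => simp [TensorProduct.smul_tmul']
    | add x y hx hy => simp only [smul_add, mul_add, hx, hy]

theorem algebraMap_smul_eq (c : k) (m : M) :
    algebraMap k R c • m = algebraMap k Λ c • m := by
  have h1 := M.tmul_smul (algebraMap k R c) 1 m
  have h2 := M.tmul_smul 1 (algebraMap k Λ c) m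
  rw [one_smul] at h1 h2
  rw [← h1, ← h2, Algebra.algebraMap_eq_smul_one, Algebra.algebraMap_eq_smul_one,
    TensorProduct.smul_tmul]

/-- `Λ` acts on `A ⊗[R] M` through `M`. -/
instance (A : Type u) [AddCommGroup A] [Module R A] : Module Λ (A ⊗[R] M) :=
  rightFactorModule Λ R A M

theorem smul_tmul_right {A : Type u} [AddCommGroup A] [Module R A] (a : Λ) (x : A) (m : M) :
    a • (x ⊗ₜ[R] m) = x ⊗ₜ[R] (a • m) := rfl

section BaseChange

variable (S : CompleteLocalAlg k) [Algebra R S]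

instance : SMulCommClass S Λ (S ⊗[R] M) where
  smul_comm s a x := by
    induction x with
    | zero => simp
    | tmul t m => simp only [smul_tmul_right, TensorProduct.smul_tmul']
    | add x y hx hy => simp only [smul_add, hx, hy]

/-- The base change `S ⊗[R] M`: here `S` acts on the left factor and `Λ` on the right one. -/
def baseChange [IsScalarTower k R S] : TensorModule k Λ S :=
  haveI : IsScalarTower k Λ (S ⊗[R] M) :=
    ⟨fun c a x => by
      induction x with
      | zero => simp
      | tmul s m =>
        rw [smul_tmul_right, smul_tmul_right, Algebra.smul_def, mul_smul, ← algebraMap_smul_eq,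
          ← TensorProduct.smul_tmul, algebraMap_smul, TensorProduct.smul_tmul']
      | add x y hx hy => simp only [smul_add, hx, hy]⟩
  { carrier := S ⊗[R] M
    module := TensorProduct.Algebra.module
    tmul_smul := fun _ _ _ => rfl }

/-- The canonical isomorphism `k ⊗[S] (S ⊗[R] M) ≃ k ⊗[R] M`. -/
def baseChangeCancel [IsScalarTower k R S] [IsScalarTower R S k] :
    (k ⊗[S] (M.baseChange S)) ≃ₗ[Λ] k ⊗[R] M :=
  let e : (k ⊗[S] (M.baseChange S)) ≃+ k ⊗[R] M :=
    (TensorProduct.AlgebraTensorModule.cancelBaseChange R S S k M).toAddEquiv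
  { e with
    map_smul' := fun a x => by
      change e (a • x) = a • e x
      induction x with
      | zero => simp
      | tmul c y =>
        change S ⊗[R] M at y
        induction y with
        | zero => exact (by simp : e (a • (c ⊗ₜ[S] (0 : M.baseChange S))) = a • e (c ⊗ₜ 0))
        | tmul s m => rfl
        | add y z hy hz =>
          have h : (c ⊗ₜ[S] (show M.baseChange S from y + z)) =
              c ⊗ₜ[S] (show M.baseChange S from y) + c ⊗ₜ[S] (show M.baseChange S from z) :=
            TensorProduct.tmul_add c (show M.baseChange S from y) (show M.baseChange S from z)
          change e (a • (c ⊗ₜ[S] (show M.baseChange S from y + z))) =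
            a • e (c ⊗ₜ[S] (show M.baseChange S from y + z))
          rw [h, smul_add, map_add, map_add, smul_add]
          exact congrArg₂ (· + ·) hy hz
      | add x y hx hy => rw [smul_add, map_add, map_add, smul_add, hx, hy] }

end BaseChange

end TensorModule

/-- A lift `(M, φ)` of the `Λ`-module `V` over `R`: a finitely generated left `RΛ`-module `M`
that is free over `R`, with an isomorphism of `Λ`-modules `φ : k ⊗[R] M ≃ V`. -/
structure ModuleLift (k : Type u) [Field k] (Λ : Type u) [Ring Λ] [Algebra k Λ]
    (V : Type u) [AddCommGroup V] [Module Λ V] (R : CompleteLocalAlg k) : Type (u + 1) where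
  /-- the module `M` -/
  M : TensorModule k Λ R
  finite : Module.Finite (R ⊗[k] Λ) M
  free : Module.Free R M
  /-- the isomorphism `φ` -/
  φ : (k ⊗[R] M) ≃ₗ[Λ] V

namespace ModuleLift

variable {k : Type u} [Field k] {Λ : Type u} [Ring Λ] [Algebra k Λ]
  {V : Type u} [AddCommGroup V] [Module Λ V] {R S : CompleteLocalAlg k}

/-- Two lifts are isomorphic, that is, they define the same deformation: there is an isomorphism
`f : M → M'` of `RΛ`-modules with `φ' ∘ (id ⊗ f) = φ`. -/
def IsIso (L L' : ModuleLift k Λ V R) : Prop :=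
  ∃ f : L.M ≃ₗ[R ⊗[k] Λ] L'.M, ∀ (c : k) (m : L.M), L'.φ (c ⊗ₜ[R] f m) = L.φ (c ⊗ₜ[R] m)

/-- The lift `(S ⊗[R] M, φ_S)`, for an `R`-algebra `S` in the category, where `φ_S` is
`k ⊗[S] (S ⊗[R] M) ≃ k ⊗[R] M ≃ V`. -/
def baseChangeAlg [Module.Finite k Λ] (L : ModuleLift k Λ V R) (S : CompleteLocalAlg k)
    [Algebra R S] [IsScalarTower k R S] [IsScalarTower R S k] : ModuleLift k Λ V S where
  M := L.M.baseChange S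
  finite := by
    have := L.finite
    have : Module.Finite R L.M := Module.Finite.trans (R ⊗[k] Λ) L.M
    have : Module.Finite S (L.M.baseChange S) :=
      inferInstanceAs (Module.Finite S (S ⊗[R] L.M))
    exact Module.Finite.of_restrictScalars_finite S (S ⊗[k] Λ) (L.M.baseChange S)
  free := by
    have := L.free
    exact inferInstanceAs (Module.Free S (S ⊗[R] L.M))
  φ := (L.M.baseChangeCancel S).trans L.φ

theorem baseChangeAlg_φ_tmul [Module.Finite k Λ] (L : ModuleLift k Λ V R)
    (S : CompleteLocalAlg k) [Algebra R S] [IsScalarTower k R S] [IsScalarTower R S k]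
    (c : k) (s : S) (m : L.M) :
    (L.baseChangeAlg S).φ (c ⊗ₜ[S] (s ⊗ₜ[R] m : S ⊗[R] L.M)) =
      L.φ ((S.residue s * c) ⊗ₜ[R] m) := rfl

/-- The base change of a lift along a morphism `θ : R → S`. -/
def baseChange [Module.Finite k Λ] (L : ModuleLift k Λ V R)
    (θ : CompleteLocalAlg.Hom R S) : ModuleLift k Λ V S :=
  letI : Algebra R S := θ.toAlgHom.toRingHom.toAlgebra
  haveI : IsScalarTower k R S :=
    IsScalarTower.of_algebraMap_eq fun c => (θ.toAlgHom.commutes c).symm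
  haveI : IsScalarTower R S k :=
    IsScalarTower.of_algebraMap_eq fun r => (θ.residue_comp r).symm
  L.baseChangeAlg S

/-- `U` is a universal deformation of `V`, and `R` is the universal deformation ring: every
lift over every `S` is, up to isomorphism, the base change of `U` along a unique morphism
`R → S`. -/
def IsUniversal [Module.Finite k Λ] (U : ModuleLift k Λ V R) : Prop :=
  ∀ (S : CompleteLocalAlg k) (L : ModuleLift k Λ V S),
    ∃! ψ : CompleteLocalAlg.Hom R S, (U.baseChange ψ).IsIso L

end ModuleLift

/-- `R` is a universal deformation ring of the `Λ`-module `V`. -/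
def IsUniversalDeformationRing (k : Type u) [Field k] (Λ : Type u) [Ring Λ] [Algebra k Λ]
    [Module.Finite k Λ] (V : Type u) [AddCommGroup V] [Module Λ V]
    (R : CompleteLocalAlg k) : Prop :=
  ∃ U : ModuleLift k Λ V R, U.IsUniversal

end

noncomputable section

/-! ### Linear algebra over local rings -/

/-! Write `i : V → P` and `p : P → V` for the maps of the exact sequence. The endomorphism `i ∘ p`
of `P` has kernel and image both equal to `i(V)`. Letting `ε` act as `i ∘ p` therefore makes `P` a
free `k[ε]`-module with `P/εP ≅ V`, a lift of `V` over `k[ε]` (`exists_lift_dualNumberAlg`). This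
lift is universal, and `k[ε] ≅ k[[t]]/(t²)`.

For universality, let `L` be a lift over `S`. A morphism `k[ε] → S` is an element `s` with `s² = 0`.
By Nakayama, the base change of `P` along it is isomorphic to `L` exactly when some `Λ`-linear `g :
P → L` satisfies `g ∘ i ∘ p = s • g` and reduces to `p` (`ModuleLift.baseChange_isIso_iff`). On the
finite projective `S`-module `H = Hom_Λ(P, L)`, precomposition with `i ∘ p` is an operator `E` with
`E² = 0`. It has to be shown that `p` lifts to an eigenvector of `E` whose eigenvalue has square
zero, and that the eigenvalue does not depend on the eigenvector chosen.

The hypotheses on `V` enter through the reduction `E'` of `E` on `Hom_Λ(P, V)`: its homology is the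
line spanned by `p` (`exists_eq_smul_add_comp`, `not_factorsThroughProjective_id`). Hence `H` is the
direct sum of `S • g`, a free module and its isomorphic image under `E`, for any `g` that reduces to
`p` (`exists_bijective_of_reduction`). Comparing coordinates gives existence
(`exists_eigenvector_lift`) and uniqueness (`eigenvalue_lift_unique`). -/

theorem LinearMap.bijective_of_bijective_mod {S N N' : Type*} [CommRing S] [AddCommGroup N]
    [Module S N] [AddCommGroup N'] [Module S N'] [Module.Finite S N] [Module.Finite S N']
    [Module.Projective S N'] {I : Ideal S} (hI : I ≤ Ideal.jacobson ⊥) (Φ : N →ₗ[S] N')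
    (hsurj : ∀ y, ∃ x, y - Φ x ∈ I • (⊤ : Submodule S N'))
    (hinj : ∀ x, Φ x = 0 → x ∈ I • (⊤ : Submodule S N)) :
    Function.Bijective Φ := by
  have hs : Function.Surjective Φ := by
    rw [← LinearMap.range_eq_top, eq_top_iff]
    refine Submodule.le_of_le_smul_of_le_jacobson_bot Module.Finite.fg_top hI fun y _ => ?_
    obtain ⟨x, hx⟩ := hsurj y
    exact Submodule.mem_sup.2 ⟨Φ x, ⟨x, rfl⟩, _, hx, by abel⟩
  refine ⟨?_, hs⟩
  obtain ⟨σ, hσ⟩ := Module.projective_lifting_property Φ LinearMap.id hs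
  -- `r` is the projection onto the kernel of `Φ` given by the splitting. Since the kernel lies in
  -- `I • N`, applying `r` puts it in `I` times itself, and Nakayama makes it zero.
  let r : N →ₗ[S] N := LinearMap.id - σ ∘ₗ Φ
  have hr : ∀ x, Φ (r x) = 0 := fun x => by
    have := LinearMap.congr_fun hσ (Φ x)
    simp only [LinearMap.coe_comp, Function.comp_apply, LinearMap.id_coe, id_eq] at this
    simp [r, this]
  have hr' : ∀ x, Φ x = 0 → r x = x := fun x hx => by simp [r, hx]
  have hbot : LinearMap.range r = ⊥ := by
    refine Submodule.eq_bot_of_le_smul_of_le_jacobson_bot I _ ?_ ?_ hI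
    · rw [LinearMap.range_eq_map]
      exact Module.Finite.fg_top.map r
    · rintro _ ⟨x, rfl⟩
      have h1 := Submodule.mem_map_of_mem (f := r) (hinj _ (hr x))
      rwa [Submodule.map_smul'', ← LinearMap.range_eq_map, hr' _ (hr x)] at h1
  rw [← LinearMap.ker_eq_bot, eq_bot_iff]
  intro x hx
  rw [← hbot]
  exact ⟨x, hr' x hx⟩

/-! ### Square-zero operators whose reduction has one-dimensional homology -/

section Eigenvector

variable {S K H W : Type*} [CommRing S] [Field K] {σ : S →+* K} [AddCommGroup H] [Module S H]
  [Module.Finite S H] [Module.Projective S H] [AddCommGroup W] [Module K W]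

/-- Let `E` be an operator on `H` with `E² = 0` whose reduction has one-dimensional homology,
spanned by `p`. Each lift of `p` is then, up to a direct sum of two copies of `Sʳ` that `E`
identifies with each other, a basis of `H`. -/
theorem exists_bijective_of_reduction [RingHomSurjective σ]
    (hσ : RingHom.ker σ ≤ Ideal.jacobson ⊥) {ρ : H →ₛₗ[σ] W}
    (hρ : Function.Surjective ρ)
    (hker : ∀ h, ρ h = 0 → h ∈ RingHom.ker σ • (⊤ : Submodule S H))
    {E : H →ₗ[S] H} {E' : W →ₗ[K] W} (hEE' : ∀ h, ρ (E h) = E' (ρ h)) (hE' : ∀ w, E' (E' w) = 0)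
    {p : W} (hp : E' p = 0) (hp' : ∀ w, E' w ≠ p)
    (hspan : ∀ w, E' w = 0 → ∃ (α : K) (w' : W), w = α • p + E' w') :
    ∃ (r : ℕ) (T : (Fin r → S) →ₗ[S] H), ∀ g : H, ρ g = p →
      Function.Bijective
        (fun v : S × (Fin r → S) × (Fin r → S) => v.1 • g + T v.2.1 + E (T v.2.2)) ∧
      ∀ (a : S) (x y : Fin r → S), ρ (a • g + T x + E (T y)) = 0 →
        σ a = 0 ∧ (∀ i, σ (x i) = 0) ∧ ∀ i, σ (y i) = 0 := by
  have hW : Module.Finite K W := Module.Finite.of_surjective ρ hρ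
  -- `E'` is injective on `C`, so `W = K p ⊕ C ⊕ E' C`. The map `T` lifts a basis of `C` to `H`, and
  -- Nakayama carries the decomposition over to `H`.
  obtain ⟨C, hC⟩ := Submodule.exists_isCompl (LinearMap.ker E')
  let b := Module.finBasis K C
  choose f hf using fun i => hρ (b i : W)
  let T : (Fin (Module.finrank K C) → S) →ₗ[S] H := Fintype.linearCombination S f
  have hT : ∀ x, ρ (T x) = ((b.equivFun.symm fun i => σ (x i) : C) : W) := fun x => by
    simp [T, Fintype.linearCombination_apply, Module.Basis.equivFun_symm_apply, hf]
  have key : ∀ g : H, ρ g = p → ∀ (a : S) (x y : Fin (Module.finrank K C) → S),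
      ρ (a • g + T x + E (T y)) = 0 → σ a = 0 ∧ (∀ i, σ (x i) = 0) ∧ ∀ i, σ (y i) = 0 := by
    intro g hg a x y h
    have hzero : ∀ z : Fin (Module.finrank K C) → S, E' (ρ (T z)) = 0 → ∀ i, σ (z i) = 0 := by
      intro z hz i
      have h1 : ((b.equivFun.symm fun i => σ (z i) : C) : W) = 0 := by
        rw [hT] at hz
        exact Submodule.disjoint_def.1 hC.disjoint _ hz (Subtype.prop _)
      have h2 : b.equivFun.symm (fun i => σ (z i)) = 0 := Subtype.ext h1
      rw [LinearEquiv.map_eq_zero_iff] at h2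
      exact congrFun h2 i
    -- Applying `E'` kills every summand except the one coming from `T x`.
    have hx : ∀ i, σ (x i) = 0 := by
      refine hzero x ?_
      have := congrArg E' h
      simpa [hEE', hE', hg, hp] using this
    have hTx : ρ (T x) = 0 := by
      rw [hT]
      simp [hx, ← Pi.zero_def]
    simp only [map_add, map_smulₛₗ, hg, hTx, add_zero, hEE'] at h
    -- Otherwise dividing by `σ a` would exhibit `p` as a value of `E'`.
    have ha : σ a = 0 := by
      by_contra hne
      apply hp' (-(σ a)⁻¹ • ρ (T y))
      rw [map_smul, neg_smul, ← smul_neg, ← eq_neg_of_add_eq_zero_left h, inv_smul_smul₀ hne]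
    refine ⟨ha, hx, hzero y ?_⟩
    simpa [ha] using h
  refine ⟨_, T, fun g hg => ⟨?_, key g hg⟩⟩
  let Φ : S × (Fin (Module.finrank K C) → S) × (Fin (Module.finrank K C) → S) →ₗ[S] H :=
    (LinearMap.toSpanSingleton S H g).coprod (T.coprod (E ∘ₗ T))
  have hΦ : ∀ v, Φ v = v.1 • g + T v.2.1 + E (T v.2.2) := fun v => by
    simp [Φ, add_assoc]
  rw [← funext hΦ]
  have hTs : ∀ c ∈ C, ∃ x, ρ (T x) = c := by
    intro c hc
    choose x hx using fun i => RingHomSurjective.is_surjective (σ := σ) (b.equivFun ⟨c, hc⟩ i)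
    refine ⟨x, ?_⟩
    rw [hT]
    simp only [hx]
    exact congrArg Subtype.val (b.equivFun.symm_apply_apply _)
  have hdec : ∀ w, ∃ u c, E' u = 0 ∧ c ∈ C ∧ w = u + c := by
    intro w
    obtain ⟨u, hu, c, hc, h⟩ := Submodule.mem_sup.1
      (hC.sup_eq_top ▸ Submodule.mem_top : w ∈ LinearMap.ker E' ⊔ C)
    exact ⟨u, c, hu, hc, h.symm⟩
  refine LinearMap.bijective_of_bijective_mod hσ Φ (fun h => ?_) fun ⟨a, x, y⟩ hv => ?_
  · obtain ⟨u, c, hu, hc, hw⟩ := hdec (ρ h)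
    obtain ⟨α, w', rfl⟩ := hspan u hu
    obtain ⟨u', c', hu', hc', rfl⟩ := hdec w'
    obtain ⟨x, rfl⟩ := hTs c hc
    obtain ⟨y, rfl⟩ := hTs c' hc'
    obtain ⟨a, rfl⟩ := RingHomSurjective.is_surjective (σ := σ) α
    refine ⟨(a, x, y), hker _ ?_⟩
    simp only [hΦ, map_sub, hw, map_add, map_smulₛₗ, hg, hEE', hu']
    abel
  · obtain ⟨ha, hx, hy⟩ := key g hg a x y (by rw [← hΦ (a, x, y), hv, map_zero])
    have hpi : ∀ z : Fin (Module.finrank K C) → S, (∀ i, σ (z i) = 0) →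
        z ∈ RingHom.ker σ • (⊤ : Submodule S (Fin (Module.finrank K C) → S)) := fun z hz => by
      rw [pi_eq_sum_univ' z]
      exact Submodule.sum_mem _ fun i _ => Submodule.smul_mem_smul (hz i) trivial
    have hmap : ∀ {A B : Type _} [AddCommGroup A] [Module S A] [AddCommGroup B] [Module S B]
        (q : A →ₗ[S] B) (z : A), z ∈ RingHom.ker σ • (⊤ : Submodule S A) →
        q z ∈ RingHom.ker σ • (⊤ : Submodule S B) := fun q z hz => by
      have := Submodule.mem_map_of_mem (f := q) hz
      rw [Submodule.map_smul''] at this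
      exact Submodule.smul_mono le_rfl le_top this
    have h1 : ((a, x, y) : S × (Fin (Module.finrank K C) → S) × (Fin (Module.finrank K C) → S)) =
        a • (1, 0, 0) + (LinearMap.inr S S _ (LinearMap.inl S _ _ x) +
          LinearMap.inr S S _ (LinearMap.inr S _ _ y)) := by simp
    rw [h1]
    exact Submodule.add_mem _ (Submodule.smul_mem_smul ha trivial)
      (Submodule.add_mem _ (hmap _ _ (hmap _ _ (hpi x hx))) (hmap _ _ (hmap _ _ (hpi y hy))))

/-- Start from any lift `g₀` of `p` and write `E g₀ = s g₀ + T a + E (T b)`. Since `E' p = 0`, `b`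
vanishes in `K`, so `g = g₀ - T b` still lifts `p`, and `E g = s g + T c` with `c = a + s b`.
Expanding `E (E g) = 0` in the decomposition attached to `g₀` forces both `s² = 0` and `c = 0`. -/
theorem exists_eigenvector_lift [RingHomSurjective σ]
    (hσ : RingHom.ker σ ≤ Ideal.jacobson ⊥) {ρ : H →ₛₗ[σ] W}
    (hρ : Function.Surjective ρ)
    (hker : ∀ h, ρ h = 0 → h ∈ RingHom.ker σ • (⊤ : Submodule S H))
    {E : H →ₗ[S] H} (hE : ∀ h, E (E h) = 0) {E' : W →ₗ[K] W}
    (hEE' : ∀ h, ρ (E h) = E' (ρ h)) (hE' : ∀ w, E' (E' w) = 0)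
    {p : W} (hp : E' p = 0) (hp' : ∀ w, E' w ≠ p)
    (hspan : ∀ w, E' w = 0 → ∃ (α : K) (w' : W), w = α • p + E' w') :
    ∃ (s : S) (g : H), s * s = 0 ∧ ρ g = p ∧ E g = s • g := by
  obtain ⟨r, T, hT⟩ := exists_bijective_of_reduction hσ hρ hker hEE' hE' hp hp' hspan
  obtain ⟨g₀, hg₀⟩ := hρ p
  obtain ⟨hbij, hmod⟩ := hT g₀ hg₀
  obtain ⟨⟨s, a, b⟩, hsab⟩ := hbij.2 (E g₀)
  dsimp only at hsab
  obtain ⟨-, -, hb⟩ := hmod s a b (by rw [hsab, hEE', hg₀, hp])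
  have hTb : ρ (T b) = 0 := by
    rw [pi_eq_sum_univ' b]
    simp [hb]
  have hEg : E (g₀ - T b) = s • (g₀ - T b) + T (a + s • b) := by
    rw [map_sub, ← hsab, map_add, map_smul, smul_sub]
    abel
  have h0 : s • E (g₀ - T b) + E (T (a + s • b)) = 0 := by
    rw [← map_smul, ← map_add, ← hEg, hE]
  have h1 : (s * s, s • (a + s • b) - (s * s) • b, a + s • b) =
      ((0, 0, 0) : S × (Fin r → S) × (Fin r → S)) := by
    apply hbij.1
    dsimp only
    simp only [zero_smul, map_zero, add_zero]
    rw [← h0, hEg]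
    simp only [map_add, map_sub, map_smul, smul_add, smul_sub, smul_smul]
    abel
  simp only [Prod.mk.injEq] at h1
  refine ⟨s, g₀ - T b, h1.1, by rw [map_sub, hTb, hg₀, sub_zero], ?_⟩
  rw [hEg, h1.2.2, map_zero, add_zero]

/-- In the decomposition attached to `g`, the coefficient `a` of `g` in `g'` reduces to `1`, so it
is a unit. The `g`-coordinates of the two sides of `E g' = s' g'` are `s a` and `s' a`. -/
theorem eigenvalue_lift_unique [RingHomSurjective σ]
    (hσ : RingHom.ker σ ≤ Ideal.jacobson ⊥) {ρ : H →ₛₗ[σ] W}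
    (hρ : Function.Surjective ρ)
    (hker : ∀ h, ρ h = 0 → h ∈ RingHom.ker σ • (⊤ : Submodule S H))
    {E : H →ₗ[S] H} (hE : ∀ h, E (E h) = 0) {E' : W →ₗ[K] W}
    (hEE' : ∀ h, ρ (E h) = E' (ρ h)) (hE' : ∀ w, E' (E' w) = 0)
    {p : W} (hp : E' p = 0) (hp' : ∀ w, E' w ≠ p)
    (hspan : ∀ w, E' w = 0 → ∃ (α : K) (w' : W), w = α • p + E' w')
    {s s' : S} {g g' : H} (hg : ρ g = p) (hg' : ρ g' = p) (hs : E g = s • g)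
    (hs' : E g' = s' • g') : s = s' := by
  obtain ⟨r, T, hT⟩ := exists_bijective_of_reduction hσ hρ hker hEE' hE' hp hp' hspan
  obtain ⟨hbij, hmod⟩ := hT g hg
  obtain ⟨⟨a, x, y⟩, h⟩ := hbij.2 g'
  dsimp only at h
  have ha : IsUnit a := by
    have h1 := (hmod (a - 1) x y (by
      rw [sub_smul, one_smul, sub_add_eq_add_sub, sub_add_eq_add_sub, h, map_sub, hg, hg',
        sub_self])).1
    have h2 := Ideal.mem_jacobson_bot.1 (hσ (RingHom.mem_ker.2 h1)) 1
    simpa using h2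
  have h1 : (s * a, (0 : Fin r → S), x) = (s' * a, s' • x, s' • y) := by
    apply hbij.1
    dsimp only
    have h2 := hs'
    rw [← h] at h2
    simp only [map_add, map_smul, hE, hs, smul_add, smul_smul, map_zero, add_zero] at h2 ⊢
    rw [mul_comm s a]
    exact h2
  exact ha.mul_right_cancel (congrArg Prod.fst h1)

end Eigenvector

/-! ### The stable endomorphism ring of a strongly Gorenstein-projective module -/

/-- The obstruction to extending `g` along `i` lies in `Ext¹(V, Q)`, by the long exact sequence. -/
theorem exists_comp_eq_of_subsingleton_ext {Λ V P Q : Type u} [Ring Λ] [AddCommGroup V]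
    [Module Λ V] [AddCommGroup P] [Module Λ P] [AddCommGroup Q] [Module Λ Q]
    [Subsingleton (Abelian.Ext.{u} (ModuleCat.of Λ V) (ModuleCat.of Λ Q) 1)]
    {W : Type u} [AddCommGroup W] [Module Λ W]
    {i : W →ₗ[Λ] P} {p : P →ₗ[Λ] V} (hi : Function.Injective i) (hip : Function.Exact i p)
    (hp : Function.Surjective p) (g : W →ₗ[Λ] Q) : ∃ g' : P →ₗ[Λ] Q, g' ∘ₗ i = g := by
  let T : ShortComplex (ModuleCat.{u} Λ) :=
    ShortComplex.mk (ModuleCat.ofHom i) (ModuleCat.ofHom p) (by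
      rw [← ModuleCat.ofHom_comp, hip.linearMap_comp_eq_zero]; rfl)
  have hT : T.ShortExact :=
    { exact := (ShortComplex.ShortExact.moduleCat_exact_iff_function_exact T).2 hip
      mono_f := (ModuleCat.mono_iff_injective _).2 hi
      epi_g := (ModuleCat.epi_iff_surjective _).2 hp }
  obtain ⟨x, hx⟩ := Abelian.Ext.contravariant_sequence_exact₁ hT (ModuleCat.of Λ Q)
    (Abelian.Ext.mk₀ (ModuleCat.ofHom g)) (add_zero 1) (Subsingleton.elim _ _)
  obtain ⟨g', rfl⟩ := (Abelian.Ext.mk₀_bijective _ _).2 x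
  rw [Abelian.Ext.mk₀_comp_mk₀] at hx
  exact ⟨g'.hom, congrArg ModuleCat.Hom.hom ((Abelian.Ext.mk₀_bijective _ _).1 hx)⟩

section

variable {k : Type u} [Field k] {Λ : Type u} [Ring Λ] [Algebra k Λ]
  {V : Type u} [AddCommGroup V] [Module k V] [Module Λ V] [IsScalarTower k Λ V]

theorem mem_projectiveEndIdeal {f : Module.End Λ V} :
    f ∈ projectiveEndIdeal Λ V ↔ FactorsThroughProjective Λ V f := by
  exact TwoSidedIdeal.mem_mk' _ _ _ _ _ _ _

theorem exists_sub_smul_factorsThroughProjective (e : StableEnd Λ V ≃ₐ[k] k)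
    (f : Module.End Λ V) : ∃ α : k, FactorsThroughProjective Λ V (f - α • LinearMap.id) := by
  refine ⟨e f, mem_projectiveEndIdeal.1 ?_⟩
  have h : (f : StableEnd Λ V) = ((algebraMap k (Module.End Λ V) (e f) : Module.End Λ V) :
      StableEnd Λ V) := by
    apply e.injective
    exact (e.commutes (e f)).symm
  have := (TwoSidedIdeal.rel_iff _ _ _).1 ((RingCon.eq _).1 h)
  rwa [Algebra.algebraMap_eq_smul_one] at this

theorem not_factorsThroughProjective_id [Nontrivial (StableEnd Λ V)] :
    ¬ FactorsThroughProjective Λ V LinearMap.id := by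
  intro h
  have h1 := (TwoSidedIdeal.mem_iff _ _).1 (mem_projectiveEndIdeal.2 h)
  exact one_ne_zero (α := StableEnd Λ V) ((RingCon.eq _).2 h1)

/-- If `0 → V → P → V → 0` is exact, then precomposition with `P → V → P` is an operator on
`Hom(P, V)` with square zero, whose homology is spanned by the class of `P → V`. -/
theorem exists_eq_smul_add_comp (hV : ∀ (P' : Type u) [AddCommGroup P'] [Module Λ P']
      [Module.Finite Λ P'] [Module.Projective Λ P'],
      Subsingleton (Abelian.Ext.{u} (ModuleCat.of Λ V) (ModuleCat.of Λ P') 1))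
    (e : StableEnd Λ V ≃ₐ[k] k) {P : Type u} [AddCommGroup P] [Module Λ P]
    {i : V →ₗ[Λ] P} {p : P →ₗ[Λ] V} (hi : Function.Injective i) (hip : Function.Exact i p)
    (hp : Function.Surjective p) {f : P →ₗ[Λ] V} (hf : f ∘ₗ i ∘ₗ p = 0) :
    ∃ (α : k) (f' : P →ₗ[Λ] V), f = α • p + f' ∘ₗ i ∘ₗ p := by
  have hfi : ∀ v, f (i v) = 0 := fun v => by
    obtain ⟨y, rfl⟩ := hp v
    exact LinearMap.congr_fun hf y
  have hker : LinearMap.ker p ≤ LinearMap.ker f := fun y hy => by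
    obtain ⟨v, rfl⟩ := (hip y).1 hy
    exact hfi v
  -- A cycle kills `i(V) = ker p`, so it has the form `f₁ ∘ p` with `f₁` an endomorphism of `V`.
  let f₁ : Module.End Λ V := (LinearMap.ker p).liftQ f hker ∘ₗ
    (p.quotKerEquivOfSurjective hp).symm.toLinearMap
  have hf₁ : ∀ y, f₁ (p y) = f y := fun y => by
    have : (p.quotKerEquivOfSurjective hp).symm (p y) = Submodule.Quotient.mk y := by
      rw [LinearEquiv.symm_apply_eq]; rfl
    simp [f₁, this]
  obtain ⟨α, Q, _, _, _, _, g, h, hgh⟩ := exists_sub_smul_factorsThroughProjective e f₁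
  have := hV Q
  -- With `g = g' ∘ i`, the part of `f₁` that factors through a projective becomes `h ∘ g' ∘ i`;
  -- composed with `p`, it is a boundary.
  obtain ⟨g', rfl⟩ := exists_comp_eq_of_subsingleton_ext hi hip hp g
  refine ⟨α, h ∘ₗ g', LinearMap.ext fun y => ?_⟩
  have h1 := LinearMap.congr_fun hgh (p y)
  simp only [LinearMap.sub_apply, LinearMap.smul_apply, hf₁, LinearMap.id_apply, sub_eq_iff_eq_add]
    at h1
  rw [h1, add_comm]
  rfl

end

/-! ### Modules of homomorphisms out of a projective module -/

section Hom

variable {Λ S P M : Type*} [Ring Λ] [CommRing S] [AddCommGroup P] [Module Λ P]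
  [Module.Projective Λ P] [AddCommGroup M] [Module Λ M] [Module S M] [SMulCommClass Λ S M]

variable (Λ S P M) in
-- `P` is a direct summand of some `Λⁿ`, and `Hom_Λ(Λⁿ, M) = Mⁿ`. Finiteness and projectivity over
-- `S` thus pass from `M` to `Hom_Λ(P, M)`.
theorem exists_retraction_pi_linearMap [Module.Finite Λ P] :
    ∃ (n : ℕ) (A : (P →ₗ[Λ] M) →ₗ[S] (Fin n → M)) (B : (Fin n → M) →ₗ[S] (P →ₗ[Λ] M)),
      B ∘ₗ A = LinearMap.id := by
  obtain ⟨n, q, hq⟩ := Module.Finite.exists_fin' Λ P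
  obtain ⟨j, hj⟩ := Module.projective_lifting_property q LinearMap.id hq
  refine ⟨n,
    { toFun := fun f a => f (q (Pi.single a 1))
      map_add' := fun _ _ => rfl
      map_smul' := fun _ _ => rfl },
    { toFun := fun m =>
        { toFun := fun y => ∑ a, j y a • m a
          map_add' := fun y z => by simp [add_smul, Finset.sum_add_distrib]
          map_smul' := fun c y => by simp [mul_smul, Finset.smul_sum] }
      map_add' := fun m m' => by
        ext y
        simp [Finset.sum_add_distrib]
      map_smul' := fun s m => by
        ext y
        simp [Finset.smul_sum, smul_comm _ s] }, ?_⟩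
  ext f y
  have h1 : q (j y) = y := LinearMap.congr_fun hj y
  simp only [LinearMap.coe_comp, LinearMap.coe_mk, AddHom.coe_mk, Function.comp_apply,
    LinearMap.id_coe, id_eq]
  simp only [← map_smul, ← map_sum]
  rw [← pi_eq_sum_univ' (j y), h1]

variable (Λ S P M) in
theorem Module.Finite.linearMap_of_projective [Module.Finite Λ P] [Module.Finite S M] :
    Module.Finite S (P →ₗ[Λ] M) := by
  obtain ⟨n, A, B, h⟩ := exists_retraction_pi_linearMap Λ S P M
  exact Module.Finite.of_surjective B fun f => ⟨A f, LinearMap.congr_fun h f⟩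

variable (Λ S P M) in
theorem Module.Projective.linearMap_of_projective [Module.Finite Λ P] [Module.Projective S M] :
    Module.Projective S (P →ₗ[Λ] M) := by
  obtain ⟨n, A, B, h⟩ := exists_retraction_pi_linearMap Λ S P M
  have : Module.Projective S (Fin n → M) :=
    Module.Projective.of_equiv (DFinsupp.linearEquivFunOnFintype (R := S) (M := fun _ : Fin n => M))
  exact Module.Projective.of_split A B h

/-- Generators `x₁, …, xₙ` of `I` define a `Λ`-linear map `Mⁿ → M` whose range contains `I • M`.
Projectivity of `P` lifts `f` to `Mⁿ`, and the components of the lift write `f` as a combination of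
the `xₐ`. -/
theorem LinearMap.mem_smul_top_of_forall_mem {I : Ideal S} (hI : I.FG) {f : P →ₗ[Λ] M}
    (hf : ∀ y, f y ∈ I • (⊤ : Submodule S M)) : f ∈ I • (⊤ : Submodule S (P →ₗ[Λ] M)) := by
  obtain ⟨n, x, hx⟩ := Submodule.fg_iff_exists_fin_generating_family.1 hI
  let X : (Fin n → M) →ₗ[Λ] M :=
    { toFun := fun m => ∑ a, x a • m a
      map_add' := fun m m' => by simp [Finset.sum_add_distrib]
      map_smul' := fun c m => by simp [Finset.smul_sum, smul_comm c] }
  have hX : ∀ m ∈ I • (⊤ : Submodule S M), m ∈ LinearMap.range X := fun m hm => by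
    induction hm using Submodule.smul_induction_on' with
    | smul r hr m _ =>
      rw [← hx] at hr
      obtain ⟨c, rfl⟩ := (Submodule.mem_span_range_iff_exists_fun S).1 hr
      refine ⟨fun a => c a • m, ?_⟩
      simp only [X, LinearMap.coe_mk, AddHom.coe_mk, Finset.sum_smul, smul_eq_mul, smul_smul,
        mul_comm]
    | add m _ m' _ h h' => exact add_mem h h'
  obtain ⟨g, hg⟩ := Module.projective_lifting_property X.rangeRestrict
    (f.codRestrict (LinearMap.range X) fun y => hX _ (hf y)) X.surjective_rangeRestrict
  have hfg : f = ∑ a, x a • (LinearMap.proj a ∘ₗ g : P →ₗ[Λ] M) := by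
    ext y
    have := congrArg Subtype.val (LinearMap.congr_fun hg y)
    simp only [LinearMap.coe_sum, Finset.sum_apply, LinearMap.smul_apply, LinearMap.coe_comp,
      Function.comp_apply, LinearMap.proj_apply]
    exact this.symm
  rw [hfg]
  refine Submodule.sum_mem _ fun a _ => Submodule.smul_mem_smul ?_ trivial
  rw [← hx]
  exact Submodule.subset_span ⟨a, rfl⟩

end Hom

/-! ### Lifts and their base change -/

namespace CompleteLocalAlg

variable {k : Type u} [Field k] (R : CompleteLocalAlg k)

/-- The augmentation as a homomorphism of rings. -/
abbrev residueHom : R →+* k := R.residue.toRingHom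

instance : RingHomSurjective R.residueHom := ⟨fun c => ⟨algebraMap k R c, R.residue.commutes c⟩⟩

theorem ker_residueHom : RingHom.ker R.residueHom = IsLocalRing.maximalIdeal R :=
  Ideal.ext fun r => R.residue_eq_zero_iff r

theorem ker_residueHom_le_jacobson : RingHom.ker R.residueHom ≤ Ideal.jacobson ⊥ := by
  rw [ker_residueHom, IsLocalRing.jacobson_eq_maximalIdeal _ bot_ne_top]

end CompleteLocalAlg

namespace TensorModule

variable {k : Type u} [Field k] {Λ : Type u} [Ring Λ] [Algebra k Λ] {R : CompleteLocalAlg k}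
  (M : TensorModule k Λ R)

instance : SMulCommClass Λ R M := SMulCommClass.symm _ _ _

theorem one_tmul_smul (a : Λ) (m : M) : ((1 : R) ⊗ₜ[k] a) • m = a • m := by
  rw [M.tmul_smul, one_smul]

theorem tmul_one_smul (r : R) (m : M) : (r ⊗ₜ[k] (1 : Λ)) • m = r • m := by
  rw [M.tmul_smul, one_smul]

theorem mem_smul_top_of_one_tmul_eq_zero {m : M} (hm : (1 : k) ⊗ₜ[R] m = 0) :
    m ∈ RingHom.ker R.residueHom • (⊤ : Submodule R M) := by
  have hex : Function.Exact (RingHom.ker R.residueHom).subtype (Algebra.linearMap R k) := fun r =>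
    ⟨fun h => ⟨⟨r, h⟩, rfl⟩, fun ⟨x, hx⟩ => hx ▸ x.2⟩
  have hs : Function.Surjective (Algebra.linearMap R k) := fun c =>
    ⟨algebraMap k R c, R.residue.commutes c⟩
  obtain ⟨z, hz⟩ := (rTensor_exact M hex hs ((1 : R) ⊗ₜ m)).1 (by
    rw [LinearMap.rTensor_tmul, Algebra.linearMap_apply, map_one, hm])
  have h1 := congrArg (TensorProduct.lid R M) hz
  rw [TensorProduct.lid_tmul, one_smul] at h1
  rw [← h1]
  clear h1 hz
  induction z with
  | zero => rw [map_zero, map_zero]; exact zero_mem _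
  | tmul x y =>
    rw [LinearMap.rTensor_tmul, TensorProduct.lid_tmul]
    exact Submodule.smul_mem_smul x.2 trivial
  | add x y hx hy => rw [map_add, map_add]; exact add_mem hx hy

end TensorModule

namespace ModuleLift

variable {k : Type u} [Field k] {Λ : Type u} [Ring Λ] [Algebra k Λ]
  {V : Type u} [AddCommGroup V] [Module Λ V] {R S : CompleteLocalAlg k}

/-- The reduction `M → k ⊗[R] M → V` of a lift `(M, φ)`. -/
def reduction (L : ModuleLift k Λ V R) : L.M →ₗ[Λ] V where
  toFun m := L.φ (1 ⊗ₜ[R] m)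
  map_add' m m' := by rw [TensorProduct.tmul_add, map_add]
  map_smul' a m := by rw [← TensorModule.smul_tmul_right, map_smul]; rfl

theorem φ_tmul (L : ModuleLift k Λ V R) (c : k) (m : L.M) :
    L.φ (c ⊗ₜ[R] m) = algebraMap k Λ c • L.reduction m := by
  have h1 : c ⊗ₜ[R] m = (1 : k) ⊗ₜ[R] (algebraMap k Λ c • m) := by
    rw [← L.M.algebraMap_smul_eq, ← TensorProduct.smul_tmul, algebraMap_smul, smul_eq_mul, mul_one]
  rw [h1, ← map_smul]
  rfl

theorem reduction_smul (L : ModuleLift k Λ V R) (r : R) (m : L.M) :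
    L.reduction (r • m) = algebraMap k Λ (R.residue r) • L.reduction m := by
  rw [← φ_tmul]
  change L.φ (1 ⊗ₜ[R] (r • m)) = _
  rw [← TensorProduct.smul_tmul, Algebra.smul_def, mul_one]
  rfl

theorem reduction_surjective (L : ModuleLift k Λ V R) : Function.Surjective L.reduction := by
  intro v
  obtain ⟨x, rfl⟩ := L.φ.surjective v
  induction x with
  | zero => exact ⟨0, by simp⟩
  | tmul c m => exact ⟨algebraMap k Λ c • m, by rw [φ_tmul, map_smul]⟩
  | add x y hx hy =>
    obtain ⟨m, hm⟩ := hx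
    obtain ⟨m', hm'⟩ := hy
    exact ⟨m + m', by rw [map_add, map_add, hm, hm']⟩

theorem mem_smul_top_of_reduction_eq_zero (L : ModuleLift k Λ V R) {m : L.M}
    (hm : L.reduction m = 0) : m ∈ RingHom.ker R.residueHom • (⊤ : Submodule R L.M) :=
  L.M.mem_smul_top_of_one_tmul_eq_zero ((LinearEquiv.map_eq_zero_iff L.φ).1 hm)

theorem finite_left [Module.Finite k Λ] (L : ModuleLift k Λ V R) : Module.Finite R L.M :=
  have := L.finite
  Module.Finite.trans (R ⊗[k] Λ) L.M

theorem reduction_baseChangeAlg [Module.Finite k Λ] (L : ModuleLift k Λ V R)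
    [Algebra R S] [IsScalarTower k R S] [IsScalarTower R S k] (s : S) (m : L.M) :
    (L.baseChangeAlg S).reduction (s ⊗ₜ[R] m : S ⊗[R] L.M) =
      algebraMap k Λ (S.residue s) • L.reduction m := by
  refine (L.baseChangeAlg_φ_tmul S 1 s m).trans ?_
  rw [mul_one, φ_tmul]

/-- The base change of `L` is isomorphic to `L'` if and only if there is a semilinear map of
`Λ`-modules between `L` and `L'` that induces the identity on `V`. -/
theorem baseChangeAlg_isIso_iff [Module.Finite k Λ] (L : ModuleLift k Λ V R)
    [Algebra R S] [IsScalarTower k R S] [IsScalarTower R S k] (L' : ModuleLift k Λ V S) :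
    (L.baseChangeAlg S).IsIso L' ↔ ∃ g : L.M →ₗ[Λ] L'.M,
      (∀ (r : R) m, g (r • m) = algebraMap R S r • g m) ∧
        ∀ m, L'.reduction (g m) = L.reduction m := by
  constructor
  · rintro ⟨f, hf⟩
    have hΛ : ∀ (a : Λ) (x : (L.baseChangeAlg S).M), f (a • x) = a • f x := fun a x => by
      rw [← TensorModule.one_tmul_smul, map_smul, TensorModule.one_tmul_smul]
    have hS : ∀ (s : S) (x : (L.baseChangeAlg S).M), f (s • x) = s • f x := fun s x => by
      rw [← TensorModule.tmul_one_smul, map_smul, TensorModule.tmul_one_smul]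
    refine ⟨{ toFun := fun m => f ((1 : S) ⊗ₜ[R] m : S ⊗[R] L.M)
              map_add' := fun m m' => ?_
              map_smul' := fun a m => hΛ a ((1 : S) ⊗ₜ[R] m : S ⊗[R] L.M) },
      fun r m => ?_, fun m => ?_⟩
    · rw [TensorProduct.tmul_add]
      exact map_add f _ _
    · refine Eq.trans ?_ (hS _ _)
      refine congrArg f (?_ : ((1 : S) ⊗ₜ[R] (r • m) : S ⊗[R] L.M) =
        algebraMap R S r • ((1 : S) ⊗ₜ[R] m : S ⊗[R] L.M))
      rw [← TensorProduct.smul_tmul, TensorProduct.smul_tmul', Algebra.smul_def, smul_eq_mul]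
    · refine (hf 1 ((1 : S) ⊗ₜ[R] m : S ⊗[R] L.M)).trans ?_
      refine (L.reduction_baseChangeAlg 1 m).trans ?_
      rw [map_one, map_one, one_smul]
  · rintro ⟨g, hg, hgV⟩
    let : Module R L'.M := Module.compHom L'.M (algebraMap R S)
    have : IsScalarTower R S L'.M := ⟨fun r s m => by
      rw [Algebra.smul_def, mul_smul]; rfl⟩
    let g' : L.M →ₗ[R] L'.M := { g with map_smul' := hg }
    let f₀ : (L.baseChangeAlg S).M →ₗ[S] L'.M := LinearMap.liftBaseChange S g'
    have hf₀ : ∀ (s : S) (m : L.M), f₀ (s ⊗ₜ[R] m : S ⊗[R] L.M) = s • g m := fun s m =>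
      LinearMap.liftBaseChange_tmul _ _ _ _
    have hΛ : ∀ (a : Λ) x, f₀ (a • x) = a • f₀ x := by
      intro a (x : S ⊗[R] L.M)
      induction x with
      | zero => exact (congrArg f₀ (smul_zero a)).trans ((map_zero f₀).trans
          ((congrArg (a • ·) (map_zero f₀)).trans (smul_zero a)).symm)
      | tmul s m =>
        refine (hf₀ s (a • m)).trans ?_
        rw [hf₀, map_smul, smul_comm]
      | add x y hx hy =>
        refine (congrArg f₀ (smul_add a x y)).trans ((map_add f₀ _ _).trans ?_)
        refine Eq.trans ?_ (congrArg (a • ·) (map_add f₀ x y)).symm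
        exact (congrArg₂ (· + ·) hx hy).trans (smul_add _ _ _).symm
    have hred : ∀ x, L'.reduction (f₀ x) = (L.baseChangeAlg S).reduction x := by
      intro (x : S ⊗[R] L.M)
      induction x with
      | zero =>
        exact (congrArg L'.reduction (map_zero f₀)).trans
          ((map_zero _).trans (map_zero (L.baseChangeAlg S).reduction).symm)
      | tmul s m =>
        rw [hf₀, reduction_smul, hgV]
        exact (L.reduction_baseChangeAlg s m).symm
      | add x y hx hy =>
        refine (congrArg L'.reduction (map_add f₀ x y)).trans ((map_add _ _ _).trans ?_)
        exact (congrArg₂ (· + ·) hx hy).trans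
          (map_add (L.baseChangeAlg S).reduction _ _).symm
    have := L'.free
    have := L'.finite_left
    have := (L.baseChangeAlg S).finite_left
    -- Both modules reduce to `V` and `f₀` is compatible with the reductions, so Nakayama applies;
    -- no inverse has to be supplied.
    have hbij : Function.Bijective f₀ := by
      refine LinearMap.bijective_of_bijective_mod S.ker_residueHom_le_jacobson f₀
        (fun y => ?_) fun x hx => ?_
      · obtain ⟨x, hx⟩ := (L.baseChangeAlg S).reduction_surjective (L'.reduction y)
        exact ⟨x, L'.mem_smul_top_of_reduction_eq_zero (by rw [map_sub, hred, hx, sub_self])⟩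
      · exact (L.baseChangeAlg S).mem_smul_top_of_reduction_eq_zero (by
          rw [← hred, hx, map_zero])
    let f₁ : (L.baseChangeAlg S).M →ₗ[S ⊗[k] Λ] L'.M :=
      { f₀ with
        map_smul' := fun t x => by
          change f₀ (t • x) = t • f₀ x
          induction t with
          | zero => rw [zero_smul, zero_smul, map_zero]
          | tmul s a => rw [TensorModule.tmul_smul, TensorModule.tmul_smul, map_smul, hΛ]
          | add t t' h h' => rw [add_smul, add_smul, map_add, h, h'] }
    refine ⟨LinearEquiv.ofBijective f₁ hbij, fun c x => ?_⟩
    rw [φ_tmul, φ_tmul]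
    exact congrArg _ (hred x)

theorem baseChange_isIso_iff [Module.Finite k Λ] (L : ModuleLift k Λ V R)
    (θ : CompleteLocalAlg.Hom R S) (L' : ModuleLift k Λ V S) :
    (L.baseChange θ).IsIso L' ↔ ∃ g : L.M →ₗ[Λ] L'.M,
      (∀ (r : R) m, g (r • m) = θ.toAlgHom r • g m) ∧
        ∀ m, L'.reduction (g m) = L.reduction m :=
  letI : Algebra R S := θ.toAlgHom.toRingHom.toAlgebra
  haveI : IsScalarTower k R S :=
    IsScalarTower.of_algebraMap_eq fun c => (θ.toAlgHom.commutes c).symm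
  haveI : IsScalarTower R S k :=
    IsScalarTower.of_algebraMap_eq fun r => (θ.residue_comp r).symm
  L.baseChangeAlg_isIso_iff L'

end ModuleLift

/-! ### Uniqueness of universal deformation rings -/

namespace CompleteLocalAlg

variable {k : Type u} [Field k] {R S T : CompleteLocalAlg k}

/-- The identity morphism. -/
def Hom.id (R : CompleteLocalAlg k) : Hom R R := ⟨AlgHom.id k R, fun _ => rfl⟩

/-- The composition of morphisms. -/
def Hom.comp (θ' : Hom S T) (θ : Hom R S) : Hom R T :=
  ⟨θ'.toAlgHom.comp θ.toAlgHom, fun r => (θ'.residue_comp _).trans (θ.residue_comp r)⟩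

end CompleteLocalAlg

namespace ModuleLift

variable {k : Type u} [Field k] {Λ : Type u} [Ring Λ] [Algebra k Λ] [Module.Finite k Λ]
  {V : Type u} [AddCommGroup V] [Module Λ V] {R S T : CompleteLocalAlg k}

theorem baseChange_id_isIso (L : ModuleLift k Λ V R) :
    (L.baseChange (CompleteLocalAlg.Hom.id R)).IsIso L :=
  (L.baseChange_isIso_iff _ L).2 ⟨LinearMap.id, fun _ _ => rfl, fun _ => rfl⟩

/-- In terms of semilinear maps this is plain composition, which avoids iterated tensor products. -/
theorem baseChange_comp_isIso {L : ModuleLift k Λ V R} {L' : ModuleLift k Λ V S}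
    {L'' : ModuleLift k Λ V T} {θ : CompleteLocalAlg.Hom R S} {θ' : CompleteLocalAlg.Hom S T}
    (h : (L.baseChange θ).IsIso L') (h' : (L'.baseChange θ').IsIso L'') :
    (L.baseChange (θ'.comp θ)).IsIso L'' := by
  obtain ⟨g, hg, hgV⟩ := (L.baseChange_isIso_iff _ _).1 h
  obtain ⟨g', hg', hgV'⟩ := (L'.baseChange_isIso_iff _ _).1 h'
  refine (L.baseChange_isIso_iff _ _).2 ⟨g' ∘ₗ g, fun r m => ?_, fun m => ?_⟩
  · rw [LinearMap.comp_apply, hg, hg']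
    rfl
  · rw [LinearMap.comp_apply, hgV', hgV]

/-- The two composites of the classifying morphisms classify `U` and `U'` themselves, as do the
identities, so uniqueness makes them mutually inverse. -/
theorem IsUniversal.nonempty_algEquiv {U : ModuleLift k Λ V R} {U' : ModuleLift k Λ V S}
    (hU : U.IsUniversal) (hU' : U'.IsUniversal) : Nonempty (R ≃ₐ[k] S) := by
  obtain ⟨θ, hθ, -⟩ := hU S U'
  obtain ⟨θ', hθ', -⟩ := hU' R U
  have h1 := (hU R U).unique (baseChange_comp_isIso hθ hθ') U.baseChange_id_isIso
  have h2 := (hU' S U').unique (baseChange_comp_isIso hθ' hθ) U'.baseChange_id_isIso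
  exact ⟨AlgEquiv.ofAlgHom θ.toAlgHom θ'.toAlgHom (congrArg CompleteLocalAlg.Hom.toAlgHom h2)
    (congrArg CompleteLocalAlg.Hom.toAlgHom h1)⟩

end ModuleLift

/-! ### The ring of dual numbers -/

section DualNumbers

open scoped DualNumber

variable (k : Type u) [Field k]

theorem isAdicComplete_of_sq_eq_bot {A : Type*} [CommRing A] {I : Ideal A} (hI : I ^ 2 = ⊥) :
    IsAdicComplete I A where
  haus' x hx := by
    have := hx 2
    rwa [hI, Submodule.bot_smul, SModEq.bot] at this
  prec' f hf := by
    -- As `I² = 0`, a Cauchy sequence is constant from index `2` on.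
    refine ⟨f 2, fun n => ?_⟩
    rcases le_total n 2 with h | h
    · exact hf h
    · have := hf h
      rw [hI, Submodule.bot_smul, SModEq.bot] at this
      rw [this]

/-- The ring of dual numbers `k[ε]` as a complete local `k`-algebra. -/
def dualNumberAlg : CompleteLocalAlg k where
  carrier := k[ε]
  isAdicComplete := isAdicComplete_of_sq_eq_bot (by
    rw [DualNumber.maximalIdeal_eq_span_singleton_eps, Ideal.span_singleton_pow, pow_two,
      DualNumber.eps_mul_eps, Ideal.span_singleton_eq_bot])
  bijective_residue := by
    refine ⟨(algebraMap k _).injective, fun x => ?_⟩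
    obtain ⟨x, rfl⟩ := IsLocalRing.residue_surjective x
    refine ⟨x.fst, ?_⟩
    rw [IsScalarTower.algebraMap_apply k k[ε], IsLocalRing.ResidueField.algebraMap_eq,
      ← sub_eq_zero, ← map_sub, IsLocalRing.residue_eq_zero_iff,
      DualNumber.maximalIdeal_eq_span_singleton_eps, Ideal.mem_span_singleton,
      ← DualNumber.fst_eq_zero_iff_eps_dvd]
    simp [TrivSqZeroExt.algebraMap_eq_inl]

variable {k}

variable (k) in
/-- The element `ε` of `k[ε]`. -/
def dualNumberEps : dualNumberAlg k := (ε : k[ε])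

theorem dualNumberEps_mul_self : dualNumberEps k * dualNumberEps k = 0 :=
  DualNumber.eps_mul_eps

theorem maximalIdeal_dualNumberAlg :
    IsLocalRing.maximalIdeal (dualNumberAlg k) = Ideal.span {dualNumberEps k} :=
  DualNumber.maximalIdeal_eq_span_singleton_eps

theorem dualNumberAlg_residue_eps : (dualNumberAlg k).residue (dualNumberEps k) = 0 := by
  rw [CompleteLocalAlg.residue_eq_zero_iff, maximalIdeal_dualNumberAlg]
  exact Ideal.mem_span_singleton_self _

theorem dualNumberAlg_eq_add (x : dualNumberAlg k) : ∃ a b : k,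
    x = algebraMap k (dualNumberAlg k) a +
      algebraMap k (dualNumberAlg k) b * dualNumberEps k := by
  refine ⟨TrivSqZeroExt.fst x, TrivSqZeroExt.snd x, ?_⟩
  have h : ∀ x : k[ε], x = algebraMap k k[ε] x.fst + algebraMap k k[ε] x.snd * ε := fun x => by
    ext <;> simp [TrivSqZeroExt.algebraMap_eq_inl]
  exact h x

theorem exists_dualNumberAlg_algHom {A : Type*} [Ring A] [Algebra k A] {a : A} (ha : a * a = 0) :
    ∃ f : dualNumberAlg k →ₐ[k] A, f (dualNumberEps k) = a :=
  ⟨DualNumber.lift (R := k) (A := k) ⟨(Algebra.ofId k A, a), ha, fun c =>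
      (Algebra.commutes c a).symm⟩,
    DualNumber.lift_apply_eps (R := k) (A := k) ⟨(Algebra.ofId k A, a), ha, fun c =>
      (Algebra.commutes c a).symm⟩⟩

/-- Compatibility with the residue maps is automatic: `s² = 0` forces the residue of `s` in the
field `k` to vanish. -/
theorem exists_dualNumberAlg_hom {S : CompleteLocalAlg k} {s : S} (hs : s * s = 0) :
    ∃ ψ : CompleteLocalAlg.Hom (dualNumberAlg k) S, ψ.toAlgHom (dualNumberEps k) = s := by
  obtain ⟨f, hf⟩ := exists_dualNumberAlg_algHom (k := k) hs
  refine ⟨⟨f, fun x => ?_⟩, hf⟩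
  obtain ⟨a, b, rfl⟩ := dualNumberAlg_eq_add x
  have h1 : S.residue s = 0 := by
    have := congrArg S.residue hs
    rwa [map_mul, map_zero, mul_self_eq_zero] at this
  simp only [map_add, map_mul, AlgHom.commutes, hf, h1, dualNumberAlg_residue_eps]

theorem dualNumberAlg_hom_ext {S : CompleteLocalAlg k}
    {ψ ψ' : CompleteLocalAlg.Hom (dualNumberAlg k) S}
    (h : ψ.toAlgHom (dualNumberEps k) = ψ'.toAlgHom (dualNumberEps k)) : ψ = ψ' := by
  refine CompleteLocalAlg.Hom.ext (AlgHom.ext fun x => ?_)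
  obtain ⟨a, b, rfl⟩ := dualNumberAlg_eq_add x
  simp only [map_add, map_mul, h, AlgHom.commutes]

variable (k) in
theorem nonempty_dualNumber_algEquiv :
    Nonempty (k[ε] ≃ₐ[k]
      (PowerSeries k ⧸ Ideal.span {(PowerSeries.X : PowerSeries k) ^ 2})) := by
  let Q := PowerSeries k ⧸ Ideal.span {(PowerSeries.X : PowerSeries k) ^ 2}
  let X : Q := Ideal.Quotient.mk _ PowerSeries.X
  have hX : X * X = 0 := by
    rw [← map_mul, ← pow_two]
    exact Ideal.Quotient.eq_zero_iff_mem.2 (Ideal.mem_span_singleton_self _)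
  let A : k[ε] →ₐ[k] Q := DualNumber.lift ⟨(Algebra.ofId k Q, X), hX, fun _ => Commute.all _ _⟩
  have hA : ∀ x : k[ε], A x = Ideal.Quotient.mk _
      (PowerSeries.C x.fst + PowerSeries.C x.snd * PowerSeries.X) := fun x => by
    have hx : x = algebraMap k k[ε] x.fst + algebraMap k k[ε] x.snd * ε := by
      ext <;> simp [TrivSqZeroExt.algebraMap_eq_inl]
    have hε : A ε = X := by simp [A]
    rw [hx, map_add, map_mul, hε, AlgHom.commutes, AlgHom.commutes, map_add, map_mul, ← hx]
    rfl
  refine ⟨AlgEquiv.ofBijective A ⟨?_, fun q => ?_⟩⟩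
  · rw [injective_iff_map_eq_zero]
    intro x hx
    rw [hA, Ideal.Quotient.eq_zero_iff_mem, Ideal.mem_span_singleton,
      PowerSeries.X_pow_dvd_iff] at hx
    have h0 := hx 0 (by norm_num)
    have h1 := hx 1 (by norm_num)
    ext
    · simpa using h0
    · simpa [PowerSeries.coeff_C] using h1
  · obtain ⟨f, rfl⟩ := Ideal.Quotient.mk_surjective q
    refine ⟨TrivSqZeroExt.inl (PowerSeries.coeff 0 f) + TrivSqZeroExt.inr (PowerSeries.coeff 1 f),
      ?_⟩
    rw [hA, ← sub_eq_zero, ← map_sub, Ideal.Quotient.eq_zero_iff_mem, Ideal.mem_span_singleton,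
      PowerSeries.X_pow_dvd_iff]
    intro m hm
    interval_cases m <;> simp [PowerSeries.coeff_C]

end DualNumbers

/-! ### The universal lift -/

section Universal

variable {k : Type u} [Field k] {Λ : Type u} [Ring Λ] [Algebra k Λ]

/-- A `Λ`-module with an endomorphism of square zero is a module over `k[ε] ⊗[k] Λ`. -/
theorem exists_tensorModule_dualNumberAlg {P : Type u} [AddCommGroup P] [Module Λ P]
    {f : Module.End Λ P} (hf : f * f = 0) :
    ∃ (M : TensorModule k Λ (dualNumberAlg k)) (j : P ≃ₗ[Λ] M),
      ∀ y, dualNumberEps k • j y = j (f y) := by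
  let : Module k P := Module.compHom P (algebraMap k Λ)
  have hkP : ∀ (c : k) (y : P), c • y = algebraMap k Λ c • y := fun _ _ => rfl
  have : IsScalarTower k Λ P := ⟨fun c a y => by rw [hkP, Algebra.smul_def, mul_smul]⟩
  obtain ⟨F, hF⟩ := exists_dualNumberAlg_algHom (k := k) hf
  let : Module (dualNumberAlg k) P := Module.compHom P F.toRingHom
  have hsmul : ∀ (x : dualNumberAlg k) (y : P), x • y = F x y := fun _ _ => rfl
  have : SMulCommClass (dualNumberAlg k) Λ P := ⟨fun x a y => by
    rw [hsmul, hsmul, map_smul]⟩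
  have : IsScalarTower k (dualNumberAlg k) P := ⟨fun c x y => by
    rw [hsmul, hsmul, map_smul, LinearMap.smul_apply]⟩
  exact ⟨{ carrier := P
           module := TensorProduct.Algebra.module
           tmul_smul := fun _ _ _ => rfl }, LinearEquiv.refl Λ P, fun y =>
    congrArg (fun g : Module.End Λ P => g y) hF⟩

variable {V : Type u} [AddCommGroup V] [Module Λ V] {M : TensorModule k Λ (dualNumberAlg k)}
  {i : V →ₗ[Λ] M} {p : M →ₗ[Λ] V}

theorem exists_eq_eps_smul (hip : Function.Exact i p) (hp : Function.Surjective p)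
    (heps : ∀ y, dualNumberEps k • y = i (p y)) {y : M} (hy : p y = 0) :
    ∃ y', y = dualNumberEps k • y' := by
  obtain ⟨v, rfl⟩ := (hip y).1 hy
  obtain ⟨y', rfl⟩ := hp v
  exact ⟨y', (heps y').symm⟩

/-- By the local criterion it suffices that `𝔪 ⊗ M → M` is injective. Every element of `𝔪 ⊗ M` is
some `ε ⊗ y`. If `ε y = i (p y) = 0`, then `p y = 0`, so `y = ε y'` and `ε ⊗ y = ε² ⊗ y' = 0`. -/
theorem free_of_exact_of_eps_smul [Module.Finite (dualNumberAlg k) M]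
    (hi : Function.Injective i) (hip : Function.Exact i p) (hp : Function.Surjective p)
    (heps : ∀ y, dualNumberEps k • y = i (p y)) : Module.Free (dualNumberAlg k) M := by
  have := Module.finitePresentation_of_finite (dualNumberAlg k) M
  apply Module.free_of_maximalIdeal_rTensor_injective
  rw [injective_iff_map_eq_zero]
  have he : dualNumberEps k ∈ IsLocalRing.maximalIdeal (dualNumberAlg k) := by
    rw [maximalIdeal_dualNumberAlg]
    exact Ideal.mem_span_singleton_self _
  have hz : ∀ z : IsLocalRing.maximalIdeal (dualNumberAlg k) ⊗[dualNumberAlg k] M,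
      ∃ y : M, z = (⟨dualNumberEps k, he⟩ : IsLocalRing.maximalIdeal (dualNumberAlg k)) ⊗ₜ y := by
    intro z
    induction z with
    | zero => exact ⟨0, (TensorProduct.tmul_zero _ _).symm⟩
    | tmul x y =>
      obtain ⟨x, hx⟩ := x
      have hx' := hx
      rw [maximalIdeal_dualNumberAlg] at hx'
      obtain ⟨c, rfl⟩ := Ideal.mem_span_singleton'.1 hx'
      exact ⟨c • y, by rw [← TensorProduct.smul_tmul]; rfl⟩
    | add z z' h h' =>
      obtain ⟨y, rfl⟩ := h
      obtain ⟨y', rfl⟩ := h'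
      exact ⟨y + y', (TensorProduct.tmul_add _ _ _).symm⟩
  intro z h
  obtain ⟨y, rfl⟩ := hz z
  have h1 := congrArg (TensorProduct.lid (dualNumberAlg k) M) h
  rw [LinearMap.rTensor_tmul, TensorProduct.lid_tmul, map_zero] at h1
  have h2 : p y = 0 := hi ((heps y).symm.trans (h1.trans (map_zero i).symm))
  obtain ⟨y', rfl⟩ := exists_eq_eps_smul hip hp heps h2
  rw [← TensorProduct.smul_tmul]
  have h3 : dualNumberEps k • (⟨dualNumberEps k, he⟩ :
      IsLocalRing.maximalIdeal (dualNumberAlg k)) = 0 := Subtype.ext dualNumberEps_mul_self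
  rw [h3, TensorProduct.zero_tmul]

variable [Module k V] [IsScalarTower k Λ V]

theorem map_smul_eq_residue_smul (hip : Function.Exact i p)
    (heps : ∀ y, dualNumberEps k • y = i (p y)) (x : dualNumberAlg k) (y : M) :
    p (x • y) = (dualNumberAlg k).residue x • p y := by
  obtain ⟨a, b, rfl⟩ := dualNumberAlg_eq_add x
  rw [add_smul, mul_smul, heps, M.algebraMap_smul_eq, M.algebraMap_smul_eq, map_add, map_smul,
    map_smul, hip.apply_apply_eq_zero, smul_zero, add_zero, map_add, map_mul,
    dualNumberAlg_residue_eps, mul_zero, add_zero, AlgHom.commutes, algebraMap_smul]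
  rfl

/-- The kernel of `p` is `ε M`, so `p` identifies `k ⊗ M = M/εM` with `V`. -/
theorem exists_equiv_of_exact_of_eps_smul (hip : Function.Exact i p) (hp : Function.Surjective p)
    (heps : ∀ y, dualNumberEps k • y = i (p y)) :
    ∃ φ : (k ⊗[dualNumberAlg k] M) ≃ₗ[Λ] V, ∀ y : M, φ (1 ⊗ₜ y) = p y := by
  let φ₀ : k ⊗[dualNumberAlg k] M →+ V := TensorProduct.liftAddHom
    (AddMonoidHom.mk' (fun c => AddMonoidHom.mk' (fun y => c • p y) fun y y' => by
      rw [map_add, smul_add]) fun c c' => by ext y; exact add_smul c c' _)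
    fun x c y => by
      change (x • c) • p y = c • p (x • y)
      rw [map_smul_eq_residue_smul hip heps, smul_smul, Algebra.smul_def, mul_comm]
      rfl
  have hφ₀ : ∀ (c : k) (y : M), φ₀ (c ⊗ₜ y) = c • p y := fun _ _ => rfl
  let φ₁ : (k ⊗[dualNumberAlg k] M) →ₗ[Λ] V :=
    { φ₀ with
      map_smul' := fun a x => by
        change φ₀ (a • x) = a • φ₀ x
        induction x with
        | zero => rw [smul_zero, map_zero, smul_zero]
        | tmul c y => rw [TensorModule.smul_tmul_right, hφ₀, hφ₀, map_smul, smul_comm]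
        | add x y hx hy => rw [smul_add, map_add, map_add, smul_add, hx, hy] }
  have hone : ∀ x : k ⊗[dualNumberAlg k] M, ∃ y : M, x = 1 ⊗ₜ y := fun x => by
    induction x with
    | zero => exact ⟨0, (TensorProduct.tmul_zero _ _).symm⟩
    | tmul c y =>
      refine ⟨algebraMap k (dualNumberAlg k) c • y, ?_⟩
      rw [← TensorProduct.smul_tmul, algebraMap_smul, smul_eq_mul, mul_one]
    | add z z' h h' =>
      obtain ⟨y, rfl⟩ := h
      obtain ⟨y', rfl⟩ := h'
      exact ⟨y + y', (TensorProduct.tmul_add _ _ _).symm⟩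
  have hbij : Function.Bijective φ₁ := by
    refine ⟨(injective_iff_map_eq_zero φ₁).2 fun x hx => ?_, fun v => ?_⟩
    · obtain ⟨y, rfl⟩ := hone x
      obtain ⟨y', rfl⟩ := exists_eq_eps_smul hip hp heps ((one_smul k _).symm.trans hx)
      rw [← TensorProduct.smul_tmul, Algebra.smul_def, mul_one]
      have : algebraMap (dualNumberAlg k) k (dualNumberEps k) = 0 := dualNumberAlg_residue_eps
      rw [this, TensorProduct.zero_tmul]
    · obtain ⟨y, rfl⟩ := hp v
      exact ⟨1 ⊗ₜ y, one_smul k _⟩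
  exact ⟨LinearEquiv.ofBijective φ₁ hbij, fun y => one_smul k _⟩

variable {P : Type u} [AddCommGroup P] [Module Λ P]

/-- If `0 → V → P → V → 0` is exact, then `P` is a lift of `V` over `k[ε]` on which `ε` acts
as `P → V → P`. -/
theorem exists_lift_dualNumberAlg [Module.Finite k Λ] [Module.Finite Λ P] {i : V →ₗ[Λ] P}
    {p : P →ₗ[Λ] V} (hi : Function.Injective i) (hip : Function.Exact i p)
    (hp : Function.Surjective p) :
    ∃ (U : ModuleLift k Λ V (dualNumberAlg k)) (j : P ≃ₗ[Λ] U.M),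
      (∀ y, dualNumberEps k • j y = j (i (p y))) ∧ ∀ y, U.reduction (j y) = p y := by
  obtain ⟨M, j, hj⟩ := exists_tensorModule_dualNumberAlg (k := k) (f := (i ∘ₗ p : Module.End Λ P))
    (LinearMap.ext fun y => by
      change i (p (i (p y))) = 0
      rw [hip.apply_apply_eq_zero, map_zero])
  have hfinΛ : Module.Finite Λ M := Module.Finite.equiv j
  have hfin : Module.Finite (dualNumberAlg k) M := by
    let : Module k M := Module.compHom M (algebraMap k Λ)
    have hk : ∀ (c : k) (m : M), c • m = algebraMap k Λ c • m := fun _ _ => rfl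
    have : IsScalarTower k Λ M := ⟨fun c a m => by rw [hk, Algebra.smul_def, mul_smul]⟩
    have : IsScalarTower k (dualNumberAlg k) M := ⟨fun c x m => by
      rw [hk, ← M.algebraMap_smul_eq, Algebra.smul_def, mul_smul]⟩
    have : Module.Finite k M := Module.Finite.trans Λ M
    exact Module.Finite.of_restrictScalars_finite k (dualNumberAlg k) M
  have hi' : Function.Injective (j.toLinearMap ∘ₗ i) := j.injective.comp hi
  have hp' : Function.Surjective (p ∘ₗ j.symm.toLinearMap) := hp.comp j.symm.surjective
  have hip' : Function.Exact (j.toLinearMap ∘ₗ i) (p ∘ₗ j.symm.toLinearMap) := fun m => by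
    obtain ⟨y, rfl⟩ := j.surjective m
    simp [hip y]
  have heps : ∀ m, dualNumberEps k • m =
      (j.toLinearMap ∘ₗ i) ((p ∘ₗ j.symm.toLinearMap) m) := fun m => by
    obtain ⟨y, rfl⟩ := j.surjective m
    simp [hj]
  obtain ⟨φ, hφ⟩ := exists_equiv_of_exact_of_eps_smul hip' hp' heps
  refine ⟨{ M := M
            finite := Module.Finite.of_restrictScalars_finite (dualNumberAlg k) _ M
            free := free_of_exact_of_eps_smul hi' hip' hp' heps
            φ := φ }, j, hj, fun y => ?_⟩
  refine (hφ (j y)).trans ?_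
  simp

/-- Precomposition with an endomorphism. -/
def precomp (S : Type*) {M : Type*} [CommRing S] [AddCommGroup M] [Module Λ M] [Module S M]
    [SMulCommClass Λ S M] (e : P →ₗ[Λ] P) : (P →ₗ[Λ] M) →ₗ[S] (P →ₗ[Λ] M) where
  toFun f := f ∘ₗ e
  map_add' _ _ := rfl
  map_smul' _ _ := rfl

variable (P) in
/-- Composition with the reduction of a lift. -/
def ModuleLift.reductionHom {S : CompleteLocalAlg k} (L : ModuleLift k Λ V S) :
    (P →ₗ[Λ] L.M) →ₛₗ[S.residueHom] (P →ₗ[Λ] V) where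
  toFun f := L.reduction ∘ₗ f
  map_add' f f' := LinearMap.comp_add _ _ _
  map_smul' s f := LinearMap.ext fun y => by
    refine (L.reduction_smul s (f y)).trans ?_
    rw [algebraMap_smul]
    rfl

theorem ModuleLift.reductionHom_surjective [Module.Projective Λ P] {S : CompleteLocalAlg k}
    (L : ModuleLift k Λ V S) :
    Function.Surjective (L.reductionHom P) := fun f =>
  Module.projective_lifting_property L.reduction f L.reduction_surjective

theorem ModuleLift.mem_smul_top_of_reductionHom_eq_zero [Module.Projective Λ P]
    {S : CompleteLocalAlg k} (L : ModuleLift k Λ V S) (f : P →ₗ[Λ] L.M)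
    (hf : L.reductionHom P f = 0) :
    f ∈ RingHom.ker S.residueHom • (⊤ : Submodule S (P →ₗ[Λ] L.M)) :=
  LinearMap.mem_smul_top_of_forall_mem (IsNoetherian.noetherian _) fun y =>
    L.mem_smul_top_of_reduction_eq_zero (LinearMap.congr_fun hf y)

theorem isUniversal_of_eps_smul [Module.Finite k Λ] [Module.Finite Λ P] [Module.Projective Λ P]
    (hV : ∀ (P' : Type u) [AddCommGroup P'] [Module Λ P']
      [Module.Finite Λ P'] [Module.Projective Λ P'],
      Subsingleton (Abelian.Ext.{u} (ModuleCat.of Λ V) (ModuleCat.of Λ P') 1))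
    (e : StableEnd Λ V ≃ₐ[k] k) {i : V →ₗ[Λ] P} {p : P →ₗ[Λ] V} (hi : Function.Injective i)
    (hip : Function.Exact i p) (hp : Function.Surjective p)
    (U : ModuleLift k Λ V (dualNumberAlg k)) (j : P ≃ₗ[Λ] U.M)
    (hj : ∀ y, dualNumberEps k • j y = j (i (p y))) (hjp : ∀ y, U.reduction (j y) = p y) :
    U.IsUniversal := by
  intro S L
  have := L.finite_left
  have := L.free
  have := Module.Finite.linearMap_of_projective Λ S P L.M
  have := Module.Projective.linearMap_of_projective Λ S P L.M
  have : Nontrivial (StableEnd Λ V) := e.toEquiv.nontrivial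
  have hpip : p ∘ₗ i ∘ₗ p = 0 := by
    rw [← LinearMap.comp_assoc, hip.linearMap_comp_eq_zero, LinearMap.zero_comp]
  have hEE : ∀ h, precomp S (M := L.M) (i ∘ₗ p) (precomp S (i ∘ₗ p) h) = 0 := fun h => by
    change (h ∘ₗ i ∘ₗ p) ∘ₗ i ∘ₗ p = 0
    rw [LinearMap.comp_assoc, LinearMap.comp_assoc, hpip, LinearMap.comp_zero, LinearMap.comp_zero]
  have hEE' : ∀ w, precomp k (M := V) (i ∘ₗ p) (precomp k (i ∘ₗ p) w) = 0 := fun w => by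
    change (w ∘ₗ i ∘ₗ p) ∘ₗ i ∘ₗ p = 0
    rw [LinearMap.comp_assoc, LinearMap.comp_assoc, hpip, LinearMap.comp_zero, LinearMap.comp_zero]
  have hcomm : ∀ h, L.reductionHom P (precomp S (i ∘ₗ p) h) =
    precomp k (i ∘ₗ p) (L.reductionHom P h) := fun _ => rfl
  -- If `w ∘ i ∘ p = p`, then `w ∘ i` is the identity since `p` is surjective, so the identity of
  -- `V` factors through `P` and the stable endomorphism ring is zero.
  have hne : ∀ w, precomp k (i ∘ₗ p) w ≠ p := fun w hw => by
    refine not_factorsThroughProjective_id (Λ := Λ) (V := V)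
      ⟨P, _, _, inferInstance, inferInstance, i, w, ?_⟩
    ext v
    obtain ⟨y, rfl⟩ := hp v
    exact (LinearMap.congr_fun hw y).symm
  have hspan : ∀ w, precomp k (i ∘ₗ p) w = 0 →
      ∃ (α : k) (w' : P →ₗ[Λ] V), w = α • p + precomp k (i ∘ₗ p) w' := fun w hw =>
    exists_eq_smul_add_comp hV e hi hip hp hw
  obtain ⟨s, g, hs, hgp, hgs⟩ := exists_eigenvector_lift S.ker_residueHom_le_jacobson
    L.reductionHom_surjective L.mem_smul_top_of_reductionHom_eq_zero hEE hcomm hEE' hpip hne hspan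
  obtain ⟨ψ, hψ⟩ := exists_dualNumberAlg_hom hs
  refine ⟨ψ, ?_, fun ψ' hψ' => dualNumberAlg_hom_ext ?_⟩
  · refine (U.baseChange_isIso_iff ψ L).2 ⟨g ∘ₗ j.symm.toLinearMap, fun r m => ?_, fun m => ?_⟩
    · obtain ⟨y, rfl⟩ := j.surjective m
      obtain ⟨a, b, rfl⟩ := dualNumberAlg_eq_add r
      have hg' : g (i (p y)) = s • g y := LinearMap.congr_fun hgs y
      rw [add_smul, mul_smul, hj, U.M.algebraMap_smul_eq, U.M.algebraMap_smul_eq]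
      simp only [map_add, map_mul, map_smul, AlgHom.commutes, hψ, LinearMap.comp_apply,
        LinearEquiv.coe_coe, LinearEquiv.symm_apply_apply, add_smul, mul_smul, hg',
        L.M.algebraMap_smul_eq]
    · obtain ⟨y, rfl⟩ := j.surjective m
      rw [hjp, LinearMap.comp_apply, LinearEquiv.coe_coe, LinearEquiv.symm_apply_apply]
      exact LinearMap.congr_fun hgp y
  · obtain ⟨g', hg', hgV'⟩ := (U.baseChange_isIso_iff ψ' L).1 hψ'
    rw [hψ]
    refine eigenvalue_lift_unique (g := g' ∘ₗ j.toLinearMap) S.ker_residueHom_le_jacobson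
      L.reductionHom_surjective L.mem_smul_top_of_reductionHom_eq_zero hEE hcomm hEE' hpip hne
      hspan ?_ hgp ?_ hgs
    · exact LinearMap.ext fun y => (hgV' (j y)).trans (hjp y)
    · refine LinearMap.ext fun y => ?_
      change g' (j (i (p y))) = ψ'.toAlgHom (dualNumberEps k) • g' (j y)
      rw [← hj, hg']

end Universal

end

theorem theorem1p2 (k : Type u) [Field k] (Λ : Type u) [Ring Λ] [Algebra k Λ]
    [Module.Finite k Λ] (V : Type u) [AddCommGroup V] [Module k V] [Module Λ V]
    [IsScalarTower k Λ V] [Module.Finite Λ V]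
    (hV : IsStronglyGorensteinProjective Λ V)
    (hEnd : Nonempty (StableEnd Λ V ≃ₐ[k] k)) :
    (∃ R : CompleteLocalAlg k, IsUniversalDeformationRing k Λ V R) ∧
      ∀ R : CompleteLocalAlg k, IsUniversalDeformationRing k Λ V R →
        Nonempty (R ≃ₐ[k]
          (PowerSeries k ⧸ Ideal.span {(PowerSeries.X : PowerSeries k) ^ 2})) := by
  obtain ⟨⟨P, _, _, i, p, _, _, hi, hip, hp⟩, hExt⟩ := hV
  obtain ⟨e⟩ := hEnd
  obtain ⟨U, j, hj, hjp⟩ := exists_lift_dualNumberAlg (k := k) hi hip hp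
  have hU : U.IsUniversal := isUniversal_of_eps_smul hExt e hi hip hp U j hj hjp
  refine ⟨⟨_, U, hU⟩, fun R ⟨U', hU'⟩ => ?_⟩
  obtain ⟨f⟩ := hU'.nonempty_algEquiv hU
  obtain ⟨f'⟩ := nonempty_dualNumber_algEquiv k
  exact ⟨f.trans f'⟩
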